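/- A system $(X,T)$ is a compact metric space $(X,\rho)$ with a homeomorphism $T:X\to X$; it is minimal if $X\neq\emptyset$ and every orbit $\{T^nx:n\in\mathbb Z\}$ is dense. A point is minimal under a homeomorphism if the subsystem on its two-sided orbit closure is minimal. A set $S\subseteq\mathbb Z$ is syndetic if for some $N\in\mathbb N$ it meets $\{i,\dots,i+N\}$ for every $i\in\mathbb Z$, thick if it contains arbitrarily long runs of consecutive integers, and piecewise syndetic if it is the intersection of a syndetic set and a thick set. A point $z$ of a system $(Z,R)$ is piecewise-syndetically recurrent if $\{n\in\mathbb Z:R^nz\in U\}$ is piecewise syndetic for every neighbourhood $U$ of $z$. An extension $\pi:(X,T)\to(Y,S)$ is a continuous surjection with $\pi T=S\pi$. It is proximal if $\liminf_{n\to\infty}\rho(T^nx,T^nx')=0$ whenever $\pi(x)=\pi(x')$, and equicontinuous if for every $\varepsilon>0$ there is $\delta>0$ such that $\pi(x)=\pi(x')$ and $\rho(x,x')<\delta$ imply $\rho(T^nx,T^nx')<\varepsilon$ for all $n\in\mathbb Z$. A minimal system is strictly PI if it is (isomorphic to) the top $W_\eta$ of a tower of pointed systems $(W_\iota)_{\iota\le\eta}$,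 $\eta$ an ordinal, with compatible base-point-preserving extensions $W_\kappa\to W_\iota$ ($\iota\le\kappa\le\eta$), in which $W_0$ is a one-point system, every $W_{\iota+1}\to W_\iota$ is proximal or equicontinuous, and $W_\nu$ is the inverse limit of $(W_\iota)_{\iota<\nu}$ for every limit ordinal $\nu\le\eta$. A system is PI if it is the image of a strictly PI system under a proximal extension. **Theorem.** Let $(X,T)$ be a minimal PI system and $x\in X$. If $(x,x)$ is piecewise-syndetically recurrent under $T\times T^2$, then $(x,x)$ is minimal under $T\times T^2$. Consequently, if there is a minimal PI system $(X,T)$ in which no point $x$ is multiply minimal, in the sense that $(x,x)$ is minimal under $T\times T^2$, then there is a minimal PI system $(X,T)$ in which no point $x$ has $(x,x)$ piecewise-syndetically recurrent under $T\times T^2$. -/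

import Mathlib

open Filter Topology

universe u

/-! ### Dynamics of a homeomorphism

The group structure on `X ≃ₜ X` is composition, so `T ^ n` with `n : ℤ` is the `n`-th iterate. -/

section Dynamics

variable {X : Type*} [TopologicalSpace X]

/-- The two-sided orbit of `x` under `T`. -/
def orbitZ (T : X ≃ₜ X) (x : X) : Set X :=
  Set.range fun n : ℤ => (T ^ n) x

/-- `(X, T)` is a minimal system: `X` is non-empty and every orbit is dense. -/
def IsMinimalSystem (T : X ≃ₜ X) : Prop :=
  Nonempty X ∧ ∀ x : X, Dense (orbitZ T x)

/-- `x` is a minimal (uniformly recurrent) point of `T`: the subsystem carried by the orbit closure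
of `x` is minimal, that is, each of its points has a dense orbit in it. -/
def IsMinimalPoint (T : X ≃ₜ X) (x : X) : Prop :=
  ∀ y ∈ closure (orbitZ T x), closure (orbitZ T x) ⊆ closure (orbitZ T y)

/-- The set of return times `N(x, U) = {n ∈ ℤ : Tⁿ x ∈ U}`. -/
def returnTimes (T : X ≃ₜ X) (x : X) (U : Set X) : Set ℤ :=
  {n : ℤ | (T ^ n) x ∈ U}

end Dynamics

/-- `S ⊆ ℤ` has bounded gaps. -/
def IsSyndetic (S : Set ℤ) : Prop :=
  ∃ N : ℕ, ∀ i : ℤ, (Set.Icc i (i + N) ∩ S).Nonempty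

/-- `S ⊆ ℤ` contains arbitrarily long runs of consecutive integers. -/
def IsThick (S : Set ℤ) : Prop :=
  ∀ N : ℕ, ∃ i : ℤ, Set.Icc i (i + N) ⊆ S

/-- `S ⊆ ℤ` is the intersection of a syndetic set and a thick set. -/
def IsPiecewiseSyndetic (S : Set ℤ) : Prop :=
  ∃ A B : Set ℤ, IsSyndetic A ∧ IsThick B ∧ S = A ∩ B

/-- `x` is piecewise-syndetically recurrent under `T`. -/
def IsPSRecurrent {X : Type*} [TopologicalSpace X] (T : X ≃ₜ X) (x : X) : Prop :=
  ∀ U ∈ 𝓝 x, IsPiecewiseSyndetic (returnTimes T x U)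

/-- The homeomorphism `T × T²` of `X × X`. -/
def prodSq {X : Type*} [TopologicalSpace X] (T : X ≃ₜ X) : (X × X) ≃ₜ (X × X) :=
  T.prodCongr (T ^ 2)

/-! ### Topological dynamical systems and their extensions -/

/-- A topological dynamical system: a compact metric space with a self-homeomorphism. -/
structure TDS : Type (u + 1) where
  carrier : Type u
  [metric : MetricSpace carrier]
  [compact : CompactSpace carrier]
  T : carrier ≃ₜ carrier

namespace TDS

instance : CoeSort TDS.{u} (Type u) := ⟨TDS.carrier⟩

instance (X : TDS.{u}) : MetricSpace X := X.metric

instance (X : TDS.{u}) : CompactSpace X := X.compact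

/-- `(x, y)` is a proximal pair: `liminf_{n → ∞} ρ(Tⁿ x, Tⁿ y) = 0`. -/
def IsProximalPair (X : TDS.{u}) (x y : X) : Prop :=
  liminf (fun n : ℤ => dist ((X.T ^ n) x) ((X.T ^ n) y)) atTop = 0

/-- `f : X → Y` is an extension (factor map): a continuous equivariant surjection. -/
structure IsExtension (X Y : TDS.{u}) (f : X → Y) : Prop where
  continuous : Continuous f
  surjective : Function.Surjective f
  equivariant : ∀ x, f (X.T x) = Y.T (f x)

/-- `f` is a proximal extension: any two points of a fibre form a proximal pair. -/
def IsProximalExtension (X Y : TDS.{u}) (f : X → Y) : Prop :=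
  IsExtension X Y f ∧ ∀ x x' : X, f x = f x' → X.IsProximalPair x x'

/-- `f` is an equicontinuous (isometric) extension. -/
def IsEquicontinuousExtension (X Y : TDS.{u}) (f : X → Y) : Prop :=
  IsExtension X Y f ∧
    ∀ ε > 0, ∃ δ > 0, ∀ x x' : X, f x = f x' → dist x x' < δ →
      ∀ n : ℤ, dist ((X.T ^ n) x) ((X.T ^ n) x') < ε

/-- A tower of pointed systems `(W ι, w ι)`, `ι ≤ η`, with a compatible family of extensions
`W κ → W ι` for `ι ≤ κ`. It starts with the trivial system, each successor step
`W (ι + 1) → W ι` is proximal or equicontinuous, and at a limit ordinal `ν` the system `W ν` is the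
inverse limit of the `W ι` with `ι < ν`: its points correspond bijectively to the compatible
families (by compactness this bijection is a homeomorphism onto the inverse limit, and it is
equivariant because the projections are). -/
structure PITower where
  η : Ordinal.{u}
  W : Set.Iic η → TDS.{u}
  w : ∀ ι, W ι
  proj : ∀ {ι κ : Set.Iic η}, ι ≤ κ → W κ → W ι
  proj_isExtension : ∀ {ι κ : Set.Iic η} (h : ι ≤ κ), IsExtension (W κ) (W ι) (proj h)
  proj_self : ∀ (ι : Set.Iic η) (x : W ι), proj (le_refl ι) x = x
  proj_proj : ∀ {ι κ μ : Set.Iic η} (h : ι ≤ κ) (h' : κ ≤ μ) (x : W μ),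
    proj h (proj h' x) = proj (h.trans h') x
  proj_base : ∀ {ι κ : Set.Iic η} (h : ι ≤ κ), proj h (w κ) = w ι
  zero : ∀ ι : Set.Iic η, (ι : Ordinal.{u}) = 0 → Subsingleton (W ι)
  succ : ∀ {ι κ : Set.Iic η} (h : ι ≤ κ), (κ : Ordinal.{u}) = Order.succ (ι : Ordinal.{u}) →
    IsProximalExtension (W κ) (W ι) (proj h) ∨ IsEquicontinuousExtension (W κ) (W ι) (proj h)
  limit : ∀ ν : Set.Iic η, Order.IsSuccLimit (ν : Ordinal.{u}) →
    ∀ x : (∀ ι : Set.Iio ν, W ι),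
      (∀ (ι κ : Set.Iio ν) (h : (ι : Set.Iic η) ≤ κ), proj h (x κ) = x ι) →
        ∃! y : W ν, ∀ ι : Set.Iio ν, proj (le_of_lt ι.2) y = x ι

/-- The top system `W η` of the tower. -/
def PITower.top (P : PITower.{u}) : TDS.{u} := P.W ⟨P.η, le_refl P.η⟩

/-- Isomorphism of systems. -/
def IsIsomorphic (X Y : TDS.{u}) : Prop :=
  ∃ e : X ≃ₜ Y, ∀ x, e (X.T x) = Y.T (e x)

/-- A strictly PI system: a minimal system that is the top of such a tower. -/
def IsStrictlyPI (X : TDS.{u}) : Prop :=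
  IsMinimalSystem X.T ∧ ∃ P : PITower.{u}, IsIsomorphic P.top X

/-- A PI system: it has a proximal extension that is strictly PI. -/
def IsPI (X : TDS.{u}) : Prop :=
  ∃ X' : TDS.{u}, X'.IsStrictlyPI ∧ ∃ θ : X' → X, IsProximalExtension X' X θ

/-- The first question, answered positively: some PI minimal system `(X, T)` has no multiply minimal point,
that is, no `x` such that `(x, x)` is a minimal point of `T × T²`. -/
def ExistsPIWithoutMultiplyMinimal : Prop :=
  ∃ X : TDS.{u}, IsMinimalSystem X.T ∧ X.IsPI ∧
    ¬ ∃ x : X, IsMinimalPoint (prodSq X.T) (x, x)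

/-- The second question, answered positively: in some PI minimal system `(X, T)` no `(x, x)` is
piecewise-syndetically recurrent under `T × T²`. -/
def ExistsPIWithoutPSRecurrent : Prop :=
  ∃ X : TDS.{u}, IsMinimalSystem X.T ∧ X.IsPI ∧
    ∀ x : X, ¬ IsPSRecurrent (prodSq X.T) (x, x)

end TDS

/-!
Call a point `z` of a system an *M-point* if the minimal points of its orbit closure accumulate at
`z`. A piecewise-syndetically recurrent point is an M-point: along the runs of the thick set one
finds a point `y` of the orbit closure whose orbit meets a given closed neighbourhood `U` of `z` with
bounded gaps; so does every point of the orbit closure of `y`, in particular a minimal one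
(`IsPSRecurrent.isMPoint`).

M-points are inherited by factors, and an M-point of a factor has an M-point above it: take a
minimal element among the closed invariant sets that meet the fibre (`IsMPoint.exists_lift`). So the
M-point `(x, x)` of `T × T²` lifts to an M-point `a` of the square of the top of the tower. Its
image in the square of each stage of the tower is then an M-point, and transfinite induction shows
that all these images are minimal points.

* Proximal steps (`IsMPoint.isMinimalPoint_of_isProximalExtension`): given two points `p`, `q` of a
  fibre of the square, the orbit closure of `(p, q)` contains a minimal point `(r, s)`. Each of the
  pairs `(r.1, s.1)` and `(r.2, s.2)` is then minimal and proximal, hence on the diagonal, so the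
  orbit closures of `p` and `q` share the point `r = s`. This avoids asking for times at which both
  coordinates become close at once. Hence an orbit closure above a minimal set contains only one
  minimal set, and an M-point lies in it.
* Equicontinuous steps (`IsMinimalPoint.of_distal_fibers`): such extensions are distal on fibres,
  and an idempotent `u` of `βℤ` that fixes the image of `a` and sends `a` to a minimal point yields a
  pair `(a, u a)` that is proximal and lies in one fibre.
* Limit steps are a compactness argument (`IsMinimalPoint.of_inverse_limit`).

Finally a factor of a minimal point is minimal, which brings the conclusion back to `(x, x)`.
-/

/-! ### Orbit closures and factor maps -/

section Orbit

variable {X Y : Type*} [TopologicalSpace X] [TopologicalSpace Y]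

theorem Function.Semiconj.homeomorph_zpow {T : X ≃ₜ X} {S : Y ≃ₜ Y} {f : X → Y}
    (h : Function.Semiconj f T S) (n : ℤ) (x : X) : f ((T ^ n) x) = (S ^ n) (f x) := by
  induction n generalizing x with
  | zero => rfl
  | succ n ih => rw [zpow_add_one, zpow_add_one, Homeomorph.mul_apply, Homeomorph.mul_apply, ih, h]
  | pred n ih =>
    rw [zpow_sub_one, zpow_sub_one, Homeomorph.mul_apply, Homeomorph.mul_apply, ih]
    congr 1
    apply S.injective
    rw [← h]
    exact (congrArg f (T.apply_symm_apply x)).trans (S.apply_symm_apply (f x)).symm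

theorem Homeomorph.zpow_add_apply (T : X ≃ₜ X) (m n : ℤ) (x : X) :
    (T ^ (m + n)) x = (T ^ m) ((T ^ n) x) := by
  rw [zpow_add, Homeomorph.mul_apply]

theorem Homeomorph.zpow_neg_apply_zpow (T : X ≃ₜ X) (n : ℤ) (x : X) :
    (T ^ (-n)) ((T ^ n) x) = x := by
  rw [← T.zpow_add_apply, neg_add_cancel, zpow_zero]; rfl

theorem mem_orbitZ_self (T : X ≃ₜ X) (x : X) : x ∈ orbitZ T x := ⟨0, rfl⟩

/-- Invariance of a set under all iterates, positive and negative. -/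
def IsInvariantZ (T : X ≃ₜ X) (C : Set X) : Prop :=
  ∀ n : ℤ, ∀ y ∈ C, (T ^ n) y ∈ C

theorem isInvariantZ_closure_orbitZ (T : X ≃ₜ X) (x : X) :
    IsInvariantZ T (closure (orbitZ T x)) := by
  intro n y hy
  refine map_mem_closure (T ^ n).continuous hy ?_
  rintro _ ⟨m, rfl⟩
  exact ⟨n + m, T.zpow_add_apply n m x⟩

theorem IsInvariantZ.closure_orbitZ_subset {T : X ≃ₜ X} {C : Set X} (h : IsInvariantZ T C)
    (hc : IsClosed C) {x : X} (hx : x ∈ C) : closure (orbitZ T x) ⊆ C := by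
  refine closure_minimal ?_ hc
  rintro _ ⟨n, rfl⟩
  exact h n x hx

theorem closure_orbitZ_mono {T : X ≃ₜ X} {x y : X} (h : y ∈ closure (orbitZ T x)) :
    closure (orbitZ T y) ⊆ closure (orbitZ T x) :=
  (isInvariantZ_closure_orbitZ T x).closure_orbitZ_subset isClosed_closure h

theorem isMinimalPoint_iff {T : X ≃ₜ X} {x : X} :
    IsMinimalPoint T x ↔ ∀ y ∈ closure (orbitZ T x), x ∈ closure (orbitZ T y) :=
  ⟨fun h y hy => h y hy (subset_closure (mem_orbitZ_self T x)),
    fun h y hy => closure_orbitZ_mono (h y hy)⟩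

theorem IsMinimalPoint.of_mem {T : X ≃ₜ X} {x y : X} (h : IsMinimalPoint T x)
    (hy : y ∈ closure (orbitZ T x)) : IsMinimalPoint T y :=
  fun z hz => (closure_orbitZ_mono hy).trans (h z (closure_orbitZ_mono hy hz))

variable {T : X ≃ₜ X} {S : Y ≃ₜ Y} {f : X → Y}

theorem map_mem_closure_orbitZ (hf : Continuous f) (h : Function.Semiconj f T S) {x y : X}
    (hy : y ∈ closure (orbitZ T x)) : f y ∈ closure (orbitZ S (f x)) := by
  refine map_mem_closure hf hy ?_
  rintro _ ⟨n, rfl⟩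
  exact ⟨n, (h.homeomorph_zpow n x).symm⟩

theorem exists_mem_closure_orbitZ_of_map [CompactSpace X] [T2Space Y] (hf : Continuous f)
    (h : Function.Semiconj f T S) {x : X} {y : Y} (hy : y ∈ closure (orbitZ S (f x))) :
    ∃ x' ∈ closure (orbitZ T x), f x' = y := by
  have hcl : IsClosed (f '' closure (orbitZ T x)) :=
    (isClosed_closure.isCompact.image hf).isClosed
  refine closure_minimal ?_ hcl hy
  rintro _ ⟨n, rfl⟩
  exact ⟨(T ^ n) x, subset_closure ⟨n, rfl⟩, h.homeomorph_zpow n x⟩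

theorem IsMinimalPoint.map [CompactSpace X] [T2Space Y] (hf : Continuous f)
    (h : Function.Semiconj f T S) {x : X} (hx : IsMinimalPoint T x) :
    IsMinimalPoint S (f x) := by
  rw [isMinimalPoint_iff] at hx ⊢
  intro y hy
  obtain ⟨x', hx', rfl⟩ := exists_mem_closure_orbitZ_of_map hf h hy
  exact map_mem_closure_orbitZ hf h (hx x' hx')

end Orbit

/-! ### Minimal closed invariant sets -/

section Minimal

variable {X : Type*} [TopologicalSpace X]

/-- Zorn's lemma for closed invariant sets. Requiring the sets to meet a fixed closed set `K` covers
both non-empty sets (`K = univ`) and sets meeting a given fibre of a factor map. -/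
theorem exists_minimal_isInvariantZ [CompactSpace X] {T : X ≃ₜ X} {K C : Set X}
    (hK : IsClosed K) (hC : IsClosed C) (hCT : IsInvariantZ T C) (hCK : (C ∩ K).Nonempty) :
    ∃ M ⊆ C, IsClosed M ∧ IsInvariantZ T M ∧ (M ∩ K).Nonempty ∧
      ∀ M' ⊆ M, IsClosed M' → IsInvariantZ T M' → (M' ∩ K).Nonempty → M' = M := by
  obtain ⟨M, hMC, hM⟩ := zorn_superset_nonempty
    {M : Set X | IsClosed M ∧ IsInvariantZ T M ∧ (M ∩ K).Nonempty} (by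
      intro c hc hchain hne
      refine ⟨⋂₀ c, ⟨isClosed_sInter fun s hs => (hc hs).1,
        fun n y hy s hs => (hc hs).2.1 n y (hy s hs), ?_⟩, fun s hs => Set.sInter_subset_of_mem hs⟩
      have : Nonempty c := hne.to_subtype
      have key := IsCompact.nonempty_iInter_of_directed_nonempty_isCompact_isClosed
        (fun s : c => (s : Set X) ∩ K) (by
          intro s t
          rcases hchain.total s.2 t.2 with h | h
          · exact ⟨s, subset_rfl, Set.inter_subset_inter_left _ h⟩
          · exact ⟨t, Set.inter_subset_inter_left _ h, subset_rfl⟩)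
        (fun s => (hc s.2).2.2) (fun s => ((hc s.2).1.inter hK).isCompact)
        (fun s => (hc s.2).1.inter hK)
      obtain ⟨y, hy⟩ := key
      rw [Set.mem_iInter] at hy
      exact ⟨y, fun s hs => (hy ⟨s, hs⟩).1, (hy ⟨hne.some, hne.some_mem⟩).2⟩) C ⟨hC, hCT, hCK⟩
  exact ⟨M, hMC, hM.prop.1, hM.prop.2.1, hM.prop.2.2, fun M' hM' h1 h2 h3 =>
    hM'.antisymm (hM.2 ⟨h1, h2, h3⟩ hM')⟩

theorem exists_isMinimalPoint_mem [CompactSpace X] {T : X ≃ₜ X} {C : Set X} (hC : IsClosed C)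
    (hCT : IsInvariantZ T C) (hne : C.Nonempty) : ∃ y ∈ C, IsMinimalPoint T y := by
  obtain ⟨M, hMC, hM, hMT, ⟨y, hy, -⟩, hmin⟩ :=
    exists_minimal_isInvariantZ isClosed_univ hC hCT (by simpa using hne)
  have key : ∀ z ∈ M, closure (orbitZ T z) = M := fun z hz =>
    hmin _ (hMT.closure_orbitZ_subset hM hz) isClosed_closure (isInvariantZ_closure_orbitZ T z)
      ⟨z, subset_closure (mem_orbitZ_self T z), trivial⟩
  refine ⟨y, hMC hy, fun z hz => ?_⟩
  rw [key y hy] at hz ⊢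
  rw [key z hz]

theorem exists_isMinimalPoint_mem_closure_orbitZ [CompactSpace X] (T : X ≃ₜ X) (x : X) :
    ∃ y ∈ closure (orbitZ T x), IsMinimalPoint T y :=
  exists_isMinimalPoint_mem isClosed_closure (isInvariantZ_closure_orbitZ T x)
    ⟨x, subset_closure (mem_orbitZ_self T x)⟩

end Minimal

/-! ### Points at which minimal points accumulate -/

section MPoint

variable {X Y : Type*} [TopologicalSpace X] [TopologicalSpace Y]

/-- `x` is an M-point: it is a limit of minimal points of its own orbit closure. Equivalently, the
orbit closure of `x` is a system with a dense set of minimal points. -/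
def IsMPoint (T : X ≃ₜ X) (x : X) : Prop :=
  x ∈ closure (closure (orbitZ T x) ∩ {y | IsMinimalPoint T y})

theorem IsPSRecurrent.isMPoint [CompactSpace X] [T2Space X] {T : X ≃ₜ X} {x : X}
    (h : IsPSRecurrent T x) : IsMPoint T x := by
  refine mem_closure_iff_nhds.2 fun V hV => ?_
  obtain ⟨U, hU, hUcl, hUV⟩ := exists_mem_nhds_isClosed_subset hV
  obtain ⟨A, B, ⟨N, hA⟩, hB, hAB⟩ := h U hU
  choose i hi using hB
  -- `y` is a limit of iterates of `x` taken at the midpoints of longer and longer runs of `B`.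
  obtain ⟨y, -, hy⟩ := isCompact_univ.exists_mapClusterPt (f := (atTop : Filter ℕ))
    (u := fun k : ℕ => (T ^ (i (2 * k) + (k : ℤ))) x) (by simp)
  have hyx : y ∈ closure (orbitZ T x) :=
    hy.mem_closure_of_mem _ (mem_map.2 (univ_mem' fun _ => ⟨_, rfl⟩))
  -- `C` is the closed set of points that visit `U` in the time interval `[0, N]`.
  let C : Set X := ⋃ n ∈ Set.Icc (0 : ℤ) N, (fun z => (T ^ n) z) ⁻¹' U
  have hC : IsClosed C := (Set.finite_Icc (0 : ℤ) N).isClosed_biUnion fun n _ =>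
    hUcl.preimage (T ^ n).continuous
  have horb : orbitZ T y ⊆ C := by
    rintro _ ⟨j, rfl⟩
    have hcl : IsClosed ((fun z => (T ^ j) z) ⁻¹' C) := hC.preimage (T ^ j).continuous
    change y ∈ (fun z => (T ^ j) z) ⁻¹' C
    rw [← hcl.closure_eq]
    refine hy.mem_closure_of_mem _ (mem_map.2 ?_)
    filter_upwards [eventually_ge_atTop (j.natAbs + N)] with k hk
    obtain ⟨n, ⟨hn1, hn2⟩, hnA⟩ := hA (i (2 * k) + k + j)
    have hnB : n ∈ B := hi (2 * k) ⟨by omega, by push_cast; omega⟩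
    have hnU : n ∈ returnTimes T x U := hAB ▸ ⟨hnA, hnB⟩
    refine Set.mem_biUnion (x := n - (i (2 * k) + k + j)) ⟨by omega, by omega⟩ ?_
    change (T ^ (n - (i (2 * k) + k + j))) ((T ^ j) ((T ^ (i (2 * k) + (k : ℤ))) x)) ∈ U
    rw [← T.zpow_add_apply, ← T.zpow_add_apply, show n - (i (2 * k) + k + j) + j +
      (i (2 * k) + (k : ℤ)) = n by ring]
    exact hnU
  obtain ⟨y', hy', hmin⟩ := exists_isMinimalPoint_mem_closure_orbitZ T y
  obtain ⟨n, -, hn⟩ := Set.mem_iUnion₂.1 (closure_minimal horb hC hy')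
  have hny' : (T ^ n) y' ∈ closure (orbitZ T y') := subset_closure ⟨n, rfl⟩
  exact ⟨(T ^ n) y', hUV hn, closure_orbitZ_mono hyx (closure_orbitZ_mono hy' hny'),
    hmin.of_mem hny'⟩

variable {T : X ≃ₜ X} {S : Y ≃ₜ Y} {f : X → Y}

theorem IsMPoint.map [CompactSpace X] [T2Space Y] (hf : Continuous f)
    (h : Function.Semiconj f T S) {x : X} (hx : IsMPoint T x) : IsMPoint S (f x) :=
  map_mem_closure hf hx fun _ hy => ⟨map_mem_closure_orbitZ hf h hy.1, hy.2.map hf h⟩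

theorem IsMPoint.exists_lift [CompactSpace X] [T2Space Y] (hf : Continuous f)
    (hsurj : Function.Surjective f) (h : Function.Semiconj f T S) {y : Y} (hy : IsMPoint S y) :
    ∃ x, f x = y ∧ IsMPoint T x := by
  obtain ⟨x₀, hx₀⟩ := hsurj y
  obtain ⟨M, -, hM, hMT, ⟨x, hxM, hxy⟩, hmin⟩ :=
    exists_minimal_isInvariantZ (T := T) (K := f ⁻¹' {y}) (C := Set.univ)
      (isClosed_singleton.preimage hf) isClosed_univ (fun _ _ _ => trivial) ⟨x₀, trivial, hx₀⟩
  refine ⟨x, hxy, ?_⟩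
  have hxM' : closure (orbitZ T x) = M :=
    hmin _ (hMT.closure_orbitZ_subset hM hxM) isClosed_closure (isInvariantZ_closure_orbitZ T x)
      ⟨x, subset_closure (mem_orbitZ_self T x), hxy⟩
  -- The closure of the minimal points of `M` is again closed and invariant and, as minimal points
  -- of the orbit closure of `y` lift to minimal points of `M`, it meets the fibre of `y`.
  have hinv : IsInvariantZ T (closure (M ∩ {z | IsMinimalPoint T z})) := by
    intro n z hz
    refine map_mem_closure (T ^ n).continuous hz ?_
    exact fun w hw => ⟨hMT n w hw.1, hw.2.of_mem (subset_closure ⟨n, rfl⟩)⟩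
  have hmeet : y ∈ f '' closure (M ∩ {z | IsMinimalPoint T z}) := by
    refine closure_minimal ?_ (isClosed_closure.isCompact.image hf).isClosed hy
    rintro m ⟨hm, hmmin⟩
    rw [← show f x = y from hxy] at hm
    obtain ⟨x', hx', rfl⟩ := exists_mem_closure_orbitZ_of_map hf h hm
    obtain ⟨z, hz, hzmin⟩ := exists_isMinimalPoint_mem_closure_orbitZ T x'
    have hback := isMinimalPoint_iff.1 hmmin _ (map_mem_closure_orbitZ hf h hz)
    obtain ⟨w, hw, hwm⟩ := exists_mem_closure_orbitZ_of_map hf h hback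
    refine ⟨w, subset_closure ⟨?_, hzmin.of_mem hw⟩, hwm⟩
    exact hxM' ▸ closure_orbitZ_mono hx' (closure_orbitZ_mono hz hw)
  obtain ⟨x', hx', hx'y⟩ := hmeet
  have heq := hmin _ (closure_minimal Set.inter_subset_left hM) isClosed_closure hinv
    ⟨x', hx', hx'y⟩
  unfold IsMPoint
  rw [hxM', heq]
  exact hxM

end MPoint

/-! ### Proximal pairs -/

section Proximal

/-- Some iterates of `x` and `y` under `T`, forward or backward, are arbitrarily close. -/
def IsProximalZ {X : Type*} [MetricSpace X] (T : X ≃ₜ X) (x y : X) : Prop :=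
  ∀ ε > 0, ∃ n : ℤ, dist ((T ^ n) x) ((T ^ n) y) < ε

theorem TDS.IsProximalPair.isProximalZ {X : TDS.{u}} {x y : X} (h : X.IsProximalPair x y) :
    IsProximalZ X.T x y := by
  intro ε hε
  by_contra! hcon
  have hle : ε ≤ liminf (fun n : ℤ => dist ((X.T ^ n) x) ((X.T ^ n) y)) atTop := by
    refine le_liminf_of_le ?_ (Eventually.of_forall hcon)
    refine IsBoundedUnder.isCoboundedUnder_ge (isBoundedUnder_of
      ⟨Metric.diam (Set.univ : Set X), fun n => ?_⟩)
    exact Metric.dist_le_diam_of_mem isCompact_univ.isBounded trivial trivial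
  rw [h] at hle
  linarith

variable {X : Type*} [MetricSpace X] [CompactSpace X]

/-- Odd times are turned into even ones by the uniform continuity of `T⁻¹`. -/
theorem IsProximalZ.sq {T : X ≃ₜ X} {x y : X} (h : IsProximalZ T x y) :
    IsProximalZ (T ^ 2) x y := by
  intro ε hε
  obtain ⟨δ, hδ, hδε⟩ := Metric.uniformContinuous_iff.1
    (CompactSpace.uniformContinuous_of_continuous (T ^ (-1 : ℤ)).continuous) ε hε
  obtain ⟨n, hn⟩ := h (min δ ε) (lt_min hδ hε)
  have hsq : ∀ k : ℤ, (T ^ 2) ^ k = T ^ (2 * k) := fun k => by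
    rw [zpow_mul]; rfl
  rcases Int.even_or_odd' n with ⟨k, rfl | rfl⟩
  · exact ⟨k, by rw [hsq]; exact hn.trans_le (min_le_right _ _)⟩
  · refine ⟨k, ?_⟩
    have := hδε (hn.trans_le (min_le_left _ _))
    rw [← T.zpow_add_apply, ← T.zpow_add_apply] at this
    rw [hsq]
    rwa [show (-1 : ℤ) + (2 * k + 1) = 2 * k by ring] at this

/-- A minimal proximal pair lies on the diagonal. -/
theorem IsProximalZ.eq_of_isMinimalPoint {T : X ≃ₜ X} {x y : X} (h : IsProximalZ T x y)
    (hmin : IsMinimalPoint (T.prodCongr T) (x, y)) : x = y := by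
  have hfst : Function.Semiconj (Prod.fst : X × X → X) (T.prodCongr T) T := fun _ => rfl
  have hsnd : Function.Semiconj (Prod.snd : X × X → X) (T.prodCongr T) T := fun _ => rfl
  have hpow : ∀ (n : ℤ) (p : X × X), ((T.prodCongr T) ^ n) p = ((T ^ n) p.1, (T ^ n) p.2) :=
    fun n p => Prod.ext (hfst.homeomorph_zpow n p) (hsnd.homeomorph_zpow n p)
  have hdiag : IsInvariantZ (T.prodCongr T) (Set.diagonal X) := by
    rintro n ⟨a, b⟩ hab
    rw [Set.mem_diagonal_iff] at hab
    rw [hpow, Set.mem_diagonal_iff]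
    exact congrArg _ hab
  obtain ⟨p, hp, hpmin⟩ := (isClosed_closure (s := orbitZ (T.prodCongr T) (x, y))).isCompact
    |>.exists_isMinOn ⟨(x, y), subset_closure (mem_orbitZ_self _ _)⟩
      (f := fun p : X × X => dist p.1 p.2) (by fun_prop)
  have hp0 : p ∈ Set.diagonal X := by
    by_contra hne
    obtain ⟨n, hn⟩ := h (dist p.1 p.2) (dist_pos.2 hne)
    have hle := hpmin (subset_closure ⟨n, rfl⟩ :
      ((T.prodCongr T) ^ n) (x, y) ∈ closure (orbitZ (T.prodCongr T) (x, y)))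
    rw [Set.mem_ofPred_eq, hpow] at hle
    exact absurd hn (not_lt.2 hle)
  exact hdiag.closure_orbitZ_subset isClosed_diagonal hp0 (isMinimalPoint_iff.1 hmin p hp)

end Proximal

/-! ### Extensions of the square of a system -/

section Extension

theorem prodSq_semiconj {X Y : Type*} [TopologicalSpace X] [TopologicalSpace Y] {T : X ≃ₜ X}
    {S : Y ≃ₜ Y} {f : X → Y} (h : Function.Semiconj f T S) :
    Function.Semiconj (Prod.map f f) (prodSq T) (prodSq S) := fun p =>
  Prod.ext (h p.1) ((h (T p.2)).trans (congrArg S (h p.2)))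

theorem prodSq_zpow_apply {X : Type*} [TopologicalSpace X] (T : X ≃ₜ X) (n : ℤ) (p : X × X) :
    (prodSq T ^ n) p = ((T ^ n) p.1, ((T ^ 2) ^ n) p.2) :=
  have hfst : Function.Semiconj (Prod.fst : X × X → X) (prodSq T) T := fun _ => rfl
  have hsnd : Function.Semiconj (Prod.snd : X × X → X) (prodSq T) (T ^ 2 : X ≃ₜ X) := fun _ => rfl
  Prod.ext (hfst.homeomorph_zpow n p) (hsnd.homeomorph_zpow n p)

/-- Two points of the square with proximal coordinates have intersecting orbit closures under
`T × T²`. -/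
theorem exists_mem_closure_orbitZ_inter_of_isProximalZ {X : Type*} [MetricSpace X] [CompactSpace X]
    {T : X ≃ₜ X} (p q : X × X)
    (hprox : ∀ r s : X × X,
      (r, s) ∈ closure (orbitZ ((prodSq T).prodCongr (prodSq T)) (p, q)) →
        IsProximalZ T r.1 s.1 ∧ IsProximalZ T r.2 s.2) :
    ∃ r, r ∈ closure (orbitZ (prodSq T) p) ∧ r ∈ closure (orbitZ (prodSq T) q) := by
  set R := (prodSq T).prodCongr (prodSq T)
  obtain ⟨⟨r, s⟩, hrs, hmin⟩ := exists_isMinimalPoint_mem_closure_orbitZ R (p, q)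
  obtain ⟨h1, h2⟩ := hprox r s hrs
  have e1 : r.1 = s.1 := h1.eq_of_isMinimalPoint <|
    hmin.map (S := T.prodCongr T)
      (f := fun w : (X × X) × (X × X) => (w.1.1, w.2.1)) (by fun_prop) fun _ => rfl
  have e2 : r.2 = s.2 := h2.sq.eq_of_isMinimalPoint <|
    hmin.map (S := (T ^ 2).prodCongr (T ^ 2))
      (f := fun w : (X × X) × (X × X) => (w.1.2, w.2.2)) (by fun_prop) fun _ => rfl
  have hfst : Function.Semiconj (Prod.fst : (X × X) × (X × X) → X × X) R (prodSq T) := fun _ => rfl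
  have hsnd : Function.Semiconj (Prod.snd : (X × X) × (X × X) → X × X) R (prodSq T) := fun _ => rfl
  refine ⟨r, map_mem_closure_orbitZ continuous_fst hfst hrs, ?_⟩
  rw [show r = s from Prod.ext e1 e2]
  exact map_mem_closure_orbitZ continuous_snd hsnd hrs

theorem TDS.IsExtension.continuous_prodMap {X Y : TDS.{u}} {f : X → Y}
    (hf : TDS.IsExtension X Y f) : Continuous (Prod.map f f) :=
  hf.continuous.prodMap hf.continuous

theorem TDS.IsExtension.semiconj_prodMap {X Y : TDS.{u}} {f : X → Y}
    (hf : TDS.IsExtension X Y f) : Function.Semiconj (Prod.map f f) (prodSq X.T) (prodSq Y.T) :=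
  prodSq_semiconj hf.equivariant

theorem IsMPoint.isMinimalPoint_of_isProximalExtension {X Y : TDS.{u}} {f : X → Y}
    (hf : TDS.IsProximalExtension X Y f) {a : X × X} (ha : IsMPoint (prodSq X.T) a)
    (hb : IsMinimalPoint (prodSq Y.T) (Prod.map f f a)) : IsMinimalPoint (prodSq X.T) a := by
  have hcont := hf.1.continuous_prodMap
  have hsemi := hf.1.semiconj_prodMap
  obtain ⟨m, hm, hmmin⟩ := exists_isMinimalPoint_mem_closure_orbitZ (prodSq X.T) a
  -- Every minimal point `m'` of the orbit closure of `a` generates the same minimal set as `m`.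
  have hsub : closure (orbitZ (prodSq X.T) a) ∩ {y | IsMinimalPoint (prodSq X.T) y} ⊆
      closure (orbitZ (prodSq X.T) m) := by
    rintro m' ⟨hm', hmin'⟩
    have hfib : Prod.map f f m ∈ closure (orbitZ (prodSq Y.T) (Prod.map f f m')) :=
      hb _ (map_mem_closure_orbitZ hcont hsemi hm') (map_mem_closure_orbitZ hcont hsemi hm)
    obtain ⟨q, hq, hqm⟩ := exists_mem_closure_orbitZ_of_map hcont hsemi hfib
    obtain ⟨r, hr, hr'⟩ := exists_mem_closure_orbitZ_inter_of_isProximalZ (T := X.T) m q (by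
      -- The pairs of points of the square in a common fibre form a closed invariant set.
      have hcl : IsClosed {w : (X × X) × (X × X) | Prod.map f f w.1 = Prod.map f f w.2} :=
        isClosed_eq (hcont.comp continuous_fst) (hcont.comp continuous_snd)
      have hfst : Function.Semiconj (Prod.fst : (X × X) × (X × X) → X × X)
        ((prodSq X.T).prodCongr (prodSq X.T)) (prodSq X.T) := fun _ => rfl
      have hsnd : Function.Semiconj (Prod.snd : (X × X) × (X × X) → X × X)
        ((prodSq X.T).prodCongr (prodSq X.T)) (prodSq X.T) := fun _ => rfl
      have hinv : IsInvariantZ ((prodSq X.T).prodCongr (prodSq X.T))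
          {w : (X × X) × (X × X) | Prod.map f f w.1 = Prod.map f f w.2} := by
        intro n w hw
        rw [Set.mem_ofPred_eq] at hw ⊢
        rw [hfst.homeomorph_zpow, hsnd.homeomorph_zpow, hsemi.homeomorph_zpow,
          hsemi.homeomorph_zpow, hw]
      intro r s hrs
      have heq : Prod.map f f r = Prod.map f f s :=
        hinv.closure_orbitZ_subset hcl (x := (m, q)) hqm.symm hrs
      exact ⟨(hf.2 _ _ (congrArg Prod.fst heq)).isProximalZ,
        (hf.2 _ _ (congrArg Prod.snd heq)).isProximalZ⟩)
    exact closure_orbitZ_mono hr (isMinimalPoint_iff.1 hmin' r (closure_orbitZ_mono hq hr'))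
  exact hmmin.of_mem (closure_minimal hsub isClosed_closure ha)

end Extension

/-! ### The action of ultrafilters and distal extensions -/

section Ultrafilter

variable {X Y : Type*} [TopologicalSpace X] [CompactSpace X] [T2Space X]
  [TopologicalSpace Y] [CompactSpace Y] [T2Space Y]

attribute [local instance] Ultrafilter.addSemigroup

/-- The action of `p ∈ βℤ` on a compact system: `p x` is the limit of `Tⁿ x` along `p`. -/
noncomputable def ultrafilterAct (T : X ≃ₜ X) (p : Ultrafilter ℤ) (x : X) : X :=
  Ultrafilter.extend (fun n : ℤ => (T ^ n) x) p

theorem ultrafilterAct_eq_iff {T : X ≃ₜ X} {p : Ultrafilter ℤ} {x y : X} :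
    ultrafilterAct T p x = y ↔ Tendsto (fun n : ℤ => (T ^ n) x) p (𝓝 y) :=
  ultrafilter_extend_eq_iff

theorem tendsto_ultrafilterAct (T : X ≃ₜ X) (p : Ultrafilter ℤ) (x : X) :
    Tendsto (fun n : ℤ => (T ^ n) x) p (𝓝 (ultrafilterAct T p x)) :=
  ultrafilterAct_eq_iff.1 rfl

theorem continuous_ultrafilterAct (T : X ≃ₜ X) (x : X) :
    Continuous fun p => ultrafilterAct T p x :=
  continuous_ultrafilter_extend _

theorem ultrafilterAct_mem_closure (T : X ≃ₜ X) (p : Ultrafilter ℤ) (x : X) :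
    ultrafilterAct T p x ∈ closure (orbitZ T x) :=
  mem_closure_of_tendsto (tendsto_ultrafilterAct T p x) (Eventually.of_forall fun n => ⟨n, rfl⟩)

theorem exists_ultrafilterAct_eq {T : X ≃ₜ X} {x y : X} (h : y ∈ closure (orbitZ T x)) :
    ∃ p, ultrafilterAct T p x = y := by
  have hcl : IsClosed (Set.range fun p => ultrafilterAct T p x) :=
    (isCompact_range (continuous_ultrafilterAct T x)).isClosed
  refine closure_minimal ?_ hcl h
  rintro _ ⟨n, rfl⟩
  exact ⟨pure n, ultrafilter_extend_extends (fun n : ℤ => (T ^ n) x) ▸ rfl⟩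

theorem ultrafilterAct_add (T : X ≃ₜ X) (p q : Ultrafilter ℤ) (x : X) :
    ultrafilterAct T (p + q) x = ultrafilterAct T p (ultrafilterAct T q x) := by
  rw [ultrafilterAct_eq_iff]
  intro U hU
  obtain ⟨V, hV, hVcl, hVU⟩ := exists_mem_nhds_isClosed_subset hU
  obtain ⟨W, hWV, hWo, hW⟩ := mem_nhds_iff.1 hV
  refine (Ultrafilter.eventually_add p q fun n => (T ^ n) x ∈ U).2 ?_
  filter_upwards [tendsto_ultrafilterAct T p _ (hWo.mem_nhds hW)] with m hm
  have := ((T ^ m).continuous.tendsto _).comp (tendsto_ultrafilterAct T q x) (hWo.mem_nhds hm)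
  filter_upwards [this] with n hn
  rw [T.zpow_add_apply]
  exact hVU (hWV hn)

theorem map_ultrafilterAct {T : X ≃ₜ X} {S : Y ≃ₜ Y} {f : X → Y} (hf : Continuous f)
    (h : Function.Semiconj f T S) (p : Ultrafilter ℤ) (x : X) :
    f (ultrafilterAct T p x) = ultrafilterAct S p (f x) := by
  symm
  rw [ultrafilterAct_eq_iff]
  refine ((hf.tendsto _).comp (tendsto_ultrafilterAct T p x)).congr fun n => ?_
  exact h.homeomorph_zpow n x

end Ultrafilter

section Distal

attribute [local instance] Ultrafilter.addSemigroup

/-- A minimal point of a factor lifts to minimal points only, if no fibre contains a non-trivial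
proximal pair. -/
theorem IsMinimalPoint.of_distal_fibers {X Y : Type*} [MetricSpace X] [CompactSpace X]
    [MetricSpace Y] [CompactSpace Y] {T : X ≃ₜ X} {S : Y ≃ₜ Y} {f : X → Y} (hf : Continuous f)
    (h : Function.Semiconj f T S)
    (hdistal : ∀ x x', f x = f x' → IsProximalZ T x x' → x = x') {a : X}
    (hb : IsMinimalPoint S (f a)) : IsMinimalPoint T a := by
  obtain ⟨m₀, hm₀, hmin₀⟩ := exists_isMinimalPoint_mem_closure_orbitZ T a
  obtain ⟨m, hm, hmb⟩ := exists_mem_closure_orbitZ_of_map hf h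
    (isMinimalPoint_iff.1 hb _ (map_mem_closure_orbitZ hf h hm₀))
  have hmin := hmin₀.of_mem hm
  obtain ⟨p, hp⟩ := exists_ultrafilterAct_eq (closure_orbitZ_mono hm₀ hm)
  obtain ⟨v, ⟨hvb, hva⟩, hv⟩ := exists_idempotent_in_compact_add_subsemigroup
    (Ultrafilter.continuous_add_left (M := ℤ))
    {q | ultrafilterAct S q (f a) = f a ∧ ultrafilterAct T q a ∈ closure (orbitZ T m)}
    ⟨p, by rw [← map_ultrafilterAct hf h, hp, hmb],
      by rw [hp]; exact subset_closure (mem_orbitZ_self T m)⟩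
    ((isClosed_singleton.preimage (continuous_ultrafilterAct S (f a))).inter
      (isClosed_closure.preimage (continuous_ultrafilterAct T a))).isCompact
    (by
      rintro q ⟨hq, -⟩ q' ⟨hq', hqa'⟩
      refine ⟨by rw [ultrafilterAct_add, hq', hq], ?_⟩
      rw [ultrafilterAct_add]
      exact closure_orbitZ_mono hqa' (ultrafilterAct_mem_closure T q _))
  have hav : a = ultrafilterAct T v a := by
    refine hdistal _ _ ?_ fun ε hε => ?_
    · rw [map_ultrafilterAct hf h, hvb]
    -- As `v` is idempotent, `Tⁿ a` and `Tⁿ (v a)` have the same limit `v a` along `v`.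
    · have h1 := tendsto_ultrafilterAct T v a
      have h2 := tendsto_ultrafilterAct T v (ultrafilterAct T v a)
      rw [← ultrafilterAct_add, hv] at h2
      have h3 := h1.dist h2
      rw [dist_self] at h3
      exact (h3.eventually_lt_const hε).exists
  rw [hav]
  exact hmin.of_mem hva

theorem IsMinimalPoint.of_isEquicontinuousExtension {X Y : TDS.{u}} {f : X → Y}
    (hf : TDS.IsEquicontinuousExtension X Y f) {a : X × X}
    (hb : IsMinimalPoint (prodSq Y.T) (Prod.map f f a)) : IsMinimalPoint (prodSq X.T) a := by
  refine hb.of_distal_fibers hf.1.continuous_prodMap hf.1.semiconj_prodMap ?_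
  intro p q hpq hprox
  refine eq_of_forall_dist_le fun ε hε => ?_
  obtain ⟨δ, hδ, hδε⟩ := hf.2 ε hε
  obtain ⟨n, hn⟩ := hprox δ hδ
  rw [prodSq_zpow_apply, prodSq_zpow_apply, Prod.dist_eq, max_lt_iff] at hn
  -- Equicontinuity is applied at time `n` and run backwards to time `0`.
  have key : ∀ (k : ℤ) (x x' : X), f x = f x' → dist ((X.T ^ k) x) ((X.T ^ k) x') < δ →
      dist x x' < ε := by
    intro k x x' hxx hk
    have := hδε ((X.T ^ k) x) ((X.T ^ k) x')
      (by rw [Function.Semiconj.homeomorph_zpow hf.1.equivariant,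
        Function.Semiconj.homeomorph_zpow hf.1.equivariant, hxx]) hk (-k)
    rwa [X.T.zpow_neg_apply_zpow, X.T.zpow_neg_apply_zpow] at this
  have hsq : (X.T ^ 2) ^ n = X.T ^ (2 * n) := by
    rw [zpow_mul]; rfl
  rw [hsq] at hn
  rw [Prod.dist_eq]
  exact max_le (key n _ _ (congrArg Prod.fst hpq) hn.1).le
    (key (2 * n) _ _ (congrArg Prod.snd hpq) hn.2).le

end Distal

/-! ### Inverse limits and the induction along the tower -/

section Tower

/-- A point is minimal if its images in a directed family of factors that separates it from all
other points are minimal. -/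
theorem IsMinimalPoint.of_inverse_limit {ι X : Type*} [Nonempty ι] [LinearOrder ι]
    [TopologicalSpace X] [CompactSpace X] {T : X ≃ₜ X} {Y : ι → Type*}
    [∀ i, TopologicalSpace (Y i)] [∀ i, T2Space (Y i)] {S : ∀ i, Y i ≃ₜ Y i} {f : ∀ i, X → Y i}
    (hf : ∀ i, Continuous (f i)) (h : ∀ i, Function.Semiconj (f i) T (S i)) {z : X}
    (hmono : ∀ i j, i ≤ j → ∀ x, f j x = f j z → f i x = f i z)
    (hsep : ∀ x, (∀ i, f i x = f i z) → x = z)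
    (hz : ∀ i, IsMinimalPoint (S i) (f i z)) : IsMinimalPoint T z := by
  rw [isMinimalPoint_iff]
  intro y hy
  have hcl : ∀ i, IsClosed (closure (orbitZ T y) ∩ f i ⁻¹' {f i z}) := fun i =>
    isClosed_closure.inter (isClosed_singleton.preimage (hf i))
  obtain ⟨w, hw⟩ := IsCompact.nonempty_iInter_of_directed_nonempty_isCompact_isClosed
    (fun i => closure (orbitZ T y) ∩ f i ⁻¹' {f i z})
    (fun i j => ⟨max i j,
      Set.inter_subset_inter_right _ fun x hx => hmono i _ (le_max_left i j) x hx,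
      Set.inter_subset_inter_right _ fun x hx => hmono j _ (le_max_right i j) x hx⟩)
    (fun i => by
      obtain ⟨x, hx, hxz⟩ := exists_mem_closure_orbitZ_of_map (hf i) (h i)
        (isMinimalPoint_iff.1 (hz i) _ (map_mem_closure_orbitZ (hf i) (h i) hy))
      exact ⟨x, hx, hxz⟩)
    (fun i => (hcl i).isCompact) hcl
  rw [Set.mem_iInter] at hw
  rw [← hsep w fun i => (hw i).2]
  exact (hw (Classical.arbitrary ι)).1

/-- In the square of the top of a PI tower every M-point for `T × T²` is minimal. -/
theorem TDS.PITower.isMinimalPoint_of_isMPoint (P : TDS.PITower.{u}) {a : P.top × P.top}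
    (ha : IsMPoint (prodSq P.top.T) a) : IsMinimalPoint (prodSq P.top.T) a := by
  let top : Set.Iic P.η := ⟨P.η, le_refl P.η⟩
  let g : ∀ ι : Set.Iic P.η, P.W top × P.W top → P.W ι × P.W ι :=
    fun ι => Prod.map (P.proj ι.2) (P.proj ι.2)
  have hgg : ∀ {ι κ : Set.Iic P.η} (h : ι ≤ κ),
      Prod.map (P.proj h) (P.proj h) (g κ a) = g ι a := fun h =>
    Prod.ext (P.proj_proj h _ a.1) (P.proj_proj h _ a.2)
  have hM : ∀ ι, IsMPoint (prodSq (P.W ι).T) (g ι a) := fun ι =>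
    ha.map (P.proj_isExtension ι.2).continuous_prodMap (P.proj_isExtension ι.2).semiconj_prodMap
  have key : ∀ o : Ordinal.{u}, ∀ ho : o ≤ P.η,
      IsMinimalPoint (prodSq (P.W ⟨o, ho⟩).T) (g ⟨o, ho⟩ a) := by
    intro o
    induction o using Ordinal.limitRecOn with
    | zero =>
      intro ho
      have := P.zero ⟨0, ho⟩ rfl
      exact isMinimalPoint_iff.2 fun y hy => by rwa [Subsingleton.elim y (g ⟨0, ho⟩ a)] at hy ⊢
    | add_one o ih =>
      intro ho
      have hlt : o ≤ o + 1 := (Order.lt_succ o).le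
      have hle : (⟨o, hlt.trans ho⟩ : Set.Iic P.η) ≤ ⟨o + 1, ho⟩ := hlt
      have ih' := ih (hlt.trans ho)
      rw [← hgg hle] at ih'
      rcases P.succ hle rfl with h | h
      · exact (hM _).isMinimalPoint_of_isProximalExtension h ih'
      · exact ih'.of_isEquicontinuousExtension h
    | limit o hlim ih =>
      intro ho
      let ν : Set.Iic P.η := ⟨o, ho⟩
      have hpos : 0 < o := hlim.bot_lt
      have : Nonempty (Set.Iio ν) := ⟨⟨⟨0, hpos.le.trans ho⟩, hpos⟩⟩
      refine IsMinimalPoint.of_inverse_limit (ι := Set.Iio ν)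
        (Y := fun ι => P.W ι × P.W ι) (S := fun ι => prodSq (P.W ι).T)
        (f := fun ι => Prod.map (P.proj (le_of_lt ι.2)) (P.proj (le_of_lt ι.2)))
        (fun ι => (P.proj_isExtension _).continuous_prodMap)
        (fun ι => (P.proj_isExtension _).semiconj_prodMap) ?_ ?_ ?_
      · intro ι κ h x hx
        have hcomp : ∀ y : P.W ν × P.W ν,
            Prod.map (P.proj (le_of_lt ι.2)) (P.proj (le_of_lt ι.2)) y =
            Prod.map (P.proj (show (ι : Set.Iic P.η) ≤ κ from h)) (P.proj h)
              (Prod.map (P.proj (le_of_lt κ.2)) (P.proj (le_of_lt κ.2)) y) := fun y =>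
          Prod.ext (P.proj_proj h _ y.1).symm (P.proj_proj h _ y.2).symm
        rw [hcomp, hcomp, hx]
      · intro x hx
        have hinj : ∀ y y' : P.W ν,
            (∀ ι : Set.Iio ν, P.proj (le_of_lt ι.2) y = P.proj (le_of_lt ι.2) y') → y = y' :=
          fun y y' hyy => (P.limit ν hlim (fun ι => P.proj (le_of_lt ι.2) y')
            (fun ι κ h => P.proj_proj h _ y')).unique hyy fun _ => rfl
        exact Prod.ext (hinj _ _ fun ι => congrArg Prod.fst (hx ι))
          (hinj _ _ fun ι => congrArg Prod.snd (hx ι))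
      · intro ι
        have := ih ι.1.1 ι.2 ι.1.2
        exact (hgg (le_of_lt ι.2)).symm ▸ this
  have htop := key P.η le_rfl
  rwa [show g ⟨P.η, le_refl P.η⟩ a = a from
    Prod.ext (P.proj_self top a.1) (P.proj_self top a.2)] at htop

theorem TDS.IsPI.isMinimalPoint_of_isPSRecurrent {X : TDS.{u}} (hX : X.IsPI) {z : X × X}
    (hz : IsPSRecurrent (prodSq X.T) z) : IsMinimalPoint (prodSq X.T) z := by
  obtain ⟨X', ⟨-, P, e, he⟩, θ, hθ, -⟩ := hX
  have hext : TDS.IsExtension P.top X (θ ∘ e) :=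
    ⟨hθ.continuous.comp e.continuous, hθ.surjective.comp e.surjective, fun x => by
      rw [Function.comp_apply, he, hθ.equivariant, Function.comp_apply]⟩
  obtain ⟨a, rfl, ha⟩ := hz.isMPoint.exists_lift hext.continuous_prodMap
    (hext.surjective.prodMap hext.surjective) hext.semiconj_prodMap
  exact (P.isMinimalPoint_of_isMPoint ha).map hext.continuous_prodMap hext.semiconj_prodMap

end Tower

theorem mainTheorem8 :
    (∀ X : TDS.{u}, IsMinimalSystem X.T → X.IsPI →
      ∀ x : X, IsPSRecurrent (prodSq X.T) (x, x) → IsMinimalPoint (prodSq X.T) (x, x)) ∧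
    (TDS.ExistsPIWithoutMultiplyMinimal.{u} → TDS.ExistsPIWithoutPSRecurrent.{u}) := by
  have main : ∀ X : TDS.{u}, IsMinimalSystem X.T → X.IsPI →
      ∀ x : X, IsPSRecurrent (prodSq X.T) (x, x) → IsMinimalPoint (prodSq X.T) (x, x) :=
    fun _ _ hPI _ hx => hPI.isMinimalPoint_of_isPSRecurrent hx
  exact ⟨main, fun ⟨X, hX, hPI, hno⟩ => ⟨X, hX, hPI, fun x hx => hno ⟨x, main X hX hPI x hx⟩⟩⟩
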